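/- Let $A$ be an associative unital ring, let $M$ be a left $A$-module that is generated by a countable set, and let $R=\operatorname{Hom}_A(M,M)^{\mathrm{op}}$ be its endomorphism ring, acting on $M$ on the right. Call a module coperfect if every descending chain of cyclic submodules of it terminates. Assume that $M$ is $\Sigma$-coperfect over $R$, that is, the direct sum $M^{(\omega)}=\bigoplus_{n=0}^{\infty}M$ is a coperfect right $R$-module. Then $M$ has a perfect decomposition: there is a family $(M_z)_{z\in Z}$ of nonzero left $A$-modules such that $M\cong\bigoplus_{z\in Z}M_z$ and the family is locally T-nilpotent, i.e. for every sequence of indices $z_1,z_2,z_3,\dots\in Z$ (repetitions allowed) and every sequence of $A$-module homomorphisms $f_i\colon M_{z_i}\to M_{z_{i+1}}$ none of which is an isomorphism, the family of composites $f_nf_{n-1}\cdots f_1\colon M_{z_1}\to M_{z_{n+1}}$, $n\ge 1$, is summable: there is an $A$-module homomorphism $M_{z_1}\to\bigoplus_{n=1}^{\infty}M_{z_{n+1}}$ whose $n$-th component is $f_n\cdots f_1$ for every $n\ge1$ (equivalently, for every $x\in M_{z_1}$ one has $f_nf_{n-1}\cdots f_1(x)=0$ for all large $n$). -/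

import Mathlib

open scoped DirectSum

universe u v w

namespace PerfectDecomp

/-- A module is countably generated if it is spanned by a countable (possibly finite) set. -/
def IsCountablyGenerated (A : Type u) [Ring A] (M : Type v) [AddCommGroup M] [Module A M] : Prop :=
  ∃ s : Set M, s.Countable ∧ Submodule.span A s = ⊤

/-- An `S`-module `N` is coperfect if every descending chain of cyclic `S`-submodules
of `N` terminates. -/
def IsCoperfect (S : Type u) [Ring S] (N : Type v) [AddCommGroup N] [Module S N] : Prop :=
  ∀ x : ℕ → N, (∀ n, Submodule.span S {x (n + 1)} ≤ Submodule.span S {x n}) →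
    ∃ n, ∀ m, n ≤ m → Submodule.span S {x m} = Submodule.span S {x n}

/-- An `S`-module `N` is `Σ`-coperfect if the direct sum of countably many copies of `N`
is a coperfect `S`-module. -/
def IsSigmaCoperfect (S : Type u) [Ring S] (N : Type v) [AddCommGroup N] [Module S N] : Prop :=
  IsCoperfect S (⨁ _ : ℕ, N)

/-- A left `A`-module `M` is endo-`Σ`-coperfect if it is `Σ`-coperfect over its endomorphism ring.
`Module.End A M` acts on `M` on the left by evaluation, which is the same thing as the right action
of the opposite ring `Hom_A(M, M)ᵒᵖ`; the action on the direct sum is componentwise. -/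
def IsEndoSigmaCoperfect (A : Type u) [Ring A] (M : Type v) [AddCommGroup M] [Module A M] : Prop :=
  IsSigmaCoperfect (Module.End A M) M

/-- A family of linear maps `f i : M → N i` is summable if it corresponds to a linear map
from `M` to the direct sum of the `N i`. -/
def IsSummableFamily {A : Type u} [Ring A] {M : Type v} [AddCommGroup M] [Module A M]
    {ι : Type w} {N : ι → Type v} [∀ i, AddCommGroup (N i)] [∀ i, Module A (N i)]
    (f : ∀ i, M →ₗ[A] N i) : Prop :=
  ∃ g : M →ₗ[A] ⨁ i, N i, ∀ (i : ι) (x : M), g x i = f i x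

/-- For `N 0 → N 1 → N 2 → ⋯` the composite `f n ∘ ⋯ ∘ f 1 ∘ f 0 : N 0 → N (n + 1)`. -/
def seqComp {A : Type u} [Ring A] {N : ℕ → Type v} [∀ n, AddCommGroup (N n)]
    [∀ n, Module A (N n)] (f : ∀ n, N n →ₗ[A] N (n + 1)) : ∀ n, N 0 →ₗ[A] N (n + 1)
  | 0 => f 0
  | n + 1 => f (n + 1) ∘ₗ seqComp f n

/-- A family of nonzero modules is locally T-nilpotent if for every sequence of indices
(repetitions allowed) and every sequence of nonisomorphisms between the corresponding modules,
the family of composites starting at the first module is summable. -/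
def IsLocallyTNilpotent (A : Type u) [Ring A] {Z : Type w} (N : Z → Type v)
    [∀ z, AddCommGroup (N z)] [∀ z, Module A (N z)] : Prop :=
  (∀ z, Nontrivial (N z)) ∧
    ∀ (z : ℕ → Z) (f : ∀ i, N (z i) →ₗ[A] N (z (i + 1))),
      (∀ i, ¬ Function.Bijective (f i)) →
        IsSummableFamily (N := fun n => N (z (n + 1))) (seqComp (N := fun n => N (z n)) f)

/-- A module has a perfect decomposition if it is isomorphic to the direct sum of a locally
T-nilpotent family of modules. -/
def HasPerfectDecomposition (A : Type u) [Ring A] (M : Type v) [AddCommGroup M] [Module A M] :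
    Prop :=
  ∃ (Z : Type v) (N : Z → Type v) (_ : ∀ z, AddCommGroup (N z)) (_ : ∀ z, Module A (N z)),
    IsLocallyTNilpotent A N ∧ Nonempty (M ≃ₗ[A] ⨁ z, N z)

end PerfectDecomp

/-!
Coperfectness of `M^(ω)` over the endomorphism ring says that for every finite tuple of elements
of `M` the orbits under a sequence of endomorphisms cannot shrink forever; so every monoid of
endomorphisms has minimal orbits of finite tuples. Since `M` is countably generated, such minimal
orbits can be chosen coherently along an increasing sequence of finite sets, which produces one
endomorphism `u` that is minimal on all finite tuples at once.

For the monoid of endomorphisms congruent to `1` modulo a locally split submodule `P`, such a `u`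
must kill `P`, so it is an idempotent with kernel `P`. Thus locally split submodules, in particular
directed unions of direct summands, are direct summands, and Zorn's lemma decomposes `M` into
indecomposable summands.

For the monoid of endomorphisms of an indecomposable summand `N` fixing some `y ≠ 0`, minimality of
`u` puts `s * u` into the Jacobson radical of the endomorphism ring whenever `s` annihilates `y`. By
stability of orbits `u * (1 - u)` is then locally nilpotent, so the Fitting decomposition makes `u`
a unit, and therefore every `t = 1 - s` fixing `y` is a unit too. Finally, if the composites along a
sequence of nonisomorphisms `f n` never annihilate `x`, stability yields `n` and `t` such that
`t ∘ f n` fixes a nonzero element; then `t ∘ f n` is invertible, and `f n` is an isomorphism onto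
an indecomposable module, a contradiction.
-/

namespace PerfectDecomp

section StableOrbits

variable {A : Type*} [Ring A] {M : Type*} [AddCommGroup M] [Module A M]
  {N : ℕ → Type*} [∀ n, AddCommGroup (N n)] [∀ n, Module A (N n)]

/-- For `N 0 → N 1 → N 2 → ⋯` the composite `f (n - 1) ∘ ⋯ ∘ f 0 : N 0 → N n`. In contrast to
`seqComp`, the sequence of composites starts with the identity of `N 0`. -/
def partialComp (f : ∀ n, N n →ₗ[A] N (n + 1)) : ∀ n, N 0 →ₗ[A] N n
  | 0 => LinearMap.id
  | n + 1 => f n ∘ₗ partialComp f n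

theorem seqComp_eq_partialComp_succ {N : ℕ → Type v} [∀ n, AddCommGroup (N n)]
    [∀ n, Module A (N n)] (f : ∀ n, N n →ₗ[A] N (n + 1)) (n : ℕ) :
    seqComp f n = partialComp f (n + 1) := by
  induction n with
  | zero => rfl
  | succ n ih => rw [seqComp, ih]; rfl

theorem partialComp_apply_eq_zero_of_le (f : ∀ n, N n →ₗ[A] N (n + 1)) {x : N 0} {m n : ℕ}
    (hmn : m ≤ n) (hm : partialComp f m x = 0) : partialComp f n x = 0 := by
  induction n, hmn using Nat.le_induction with
  | base => exact hm
  | succ n _ ih => rw [partialComp, LinearMap.comp_apply, ih, map_zero]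

variable (A M) in
/-- A module has stable orbits if for each finite tuple of its elements the cyclic submodules
generated, over the endomorphism ring, by the successive images of the tuple under a sequence of
endomorphisms form a chain that does not descend strictly forever. Tuples are encoded by the finite
sets of their entries. -/
def HasStableOrbits : Prop :=
  ∀ (F : Finset M) (s : ℕ → Module.End A M), ∃ (n : ℕ) (t : Module.End A M),
    ∀ x ∈ F, t (s n (partialComp (N := fun _ => M) s n x)) = partialComp (N := fun _ => M) s n x

theorem exists_directSum_forall_mem_exists_apply_eq {G : Type*} [AddCommMonoid G] (F : Finset G) :
    ∃ ξ : ⨁ _ : ℕ, G, ∀ x ∈ F, ∃ i, ξ i = x := by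
  refine ⟨DirectSum.mk (fun _ => G) (Finset.range F.toList.length) fun i => F.toList.getD i 0,
    fun x hx => ?_⟩
  obtain ⟨i, hi, rfl⟩ := List.getElem_of_mem (Finset.mem_toList.2 hx)
  exact ⟨i, (DirectSum.mk_apply_of_mem (Finset.mem_range.2 hi)).trans (List.getD_eq_getElem _ _ hi)⟩

theorem IsEndoSigmaCoperfect.hasStableOrbits (h : IsEndoSigmaCoperfect A M) :
    HasStableOrbits A M := by
  intro F s
  obtain ⟨ξ, hξ⟩ := exists_directSum_forall_mem_exists_apply_eq F
  let c : ℕ → Module.End A M := partialComp (N := fun _ => M) s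
  have hsucc (n : ℕ) : c (n + 1) • ξ = s n • c n • ξ := mul_smul (s n) (c n) ξ
  obtain ⟨n, hn⟩ := h (fun n => c n • ξ) fun n => by
    rw [Submodule.span_singleton_le_iff_mem, hsucc]
    exact Submodule.smul_mem _ _ (Submodule.mem_span_singleton_self _)
  have hmem : c n • ξ ∈ Submodule.span (Module.End A M) {c (n + 1) • ξ} :=
    hn (n + 1) n.le_succ ▸ Submodule.mem_span_singleton_self _
  obtain ⟨t, ht⟩ := Submodule.mem_span_singleton.1 hmem
  refine ⟨n, t, fun x hx => ?_⟩
  obtain ⟨i, rfl⟩ := hξ x hx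
  have hi := congrArg (fun η : ⨁ _ : ℕ, M => η i) ht
  simpa only [hsucc, DirectSum.smul_apply, Module.End.smul_def] using hi

theorem HasStableOrbits.exists_leftInverse_partialComp (h : HasStableOrbits A M)
    (i : ∀ n, N n →ₗ[A] M) (π : ∀ n, M →ₗ[A] N n) (hπ : ∀ n, Function.LeftInverse (π n) (i n))
    (f : ∀ n, N n →ₗ[A] N (n + 1)) (F : Finset (N 0)) :
    ∃ (n : ℕ) (t : N (n + 1) →ₗ[A] N n),
      ∀ x ∈ F, t (f n (partialComp f n x)) = partialComp f n x := by
  classical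
  let s (n : ℕ) : Module.End A M := i (n + 1) ∘ₗ f n ∘ₗ π n
  have hs (n : ℕ) (x : N n) : s n (i n x) = i (n + 1) (f n x) :=
    congrArg (fun z => i (n + 1) (f n z)) (hπ n x)
  have hcomp (n : ℕ) (x : N 0) :
      partialComp (N := fun _ => M) s n (i 0 x) = i n (partialComp f n x) := by
    induction n with
    | zero => rfl
    | succ n ih => rw [partialComp, LinearMap.comp_apply, ih, hs, partialComp, LinearMap.comp_apply]
  obtain ⟨n, t, ht⟩ := h (F.image (i 0)) s
  refine ⟨n, π n ∘ₗ t ∘ₗ i (n + 1), fun x hx => ?_⟩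
  have hx := ht (i 0 x) (Finset.mem_image_of_mem _ hx)
  rw [hcomp, hs] at hx
  rw [LinearMap.comp_apply, LinearMap.comp_apply, hx, hπ]

theorem HasStableOrbits.of_leftInverse {M' : Type*} [AddCommGroup M'] [Module A M']
    (h : HasStableOrbits A M) (i : M' →ₗ[A] M) (π : M →ₗ[A] M') (hπ : Function.LeftInverse π i) :
    HasStableOrbits A M' := fun F s =>
  h.exists_leftInverse_partialComp (N := fun _ => M') (fun _ => i) (fun _ => π) (fun _ => hπ) s F

theorem HasStableOrbits.exists_mem_forall_mul_mem (h : HasStableOrbits A M)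
    {S : Set (Module.End A M)} (hS : S.Nonempty) (F : Finset M) :
    ∃ g ∈ S, ∀ s, s * g ∈ S → ∃ t : Module.End A M, ∀ x ∈ F, t (s (g x)) = g x := by
  classical
  by_contra! hcon
  choose! s hsS hs using hcon
  obtain ⟨g₀, hg₀⟩ := hS
  let g (n : ℕ) : Module.End A M := Nat.rec g₀ (fun _ p => s p * p) n
  have hgS (n : ℕ) : g n ∈ S := by
    induction n with
    | zero => exact hg₀
    | succ n ih => exact hsS _ ih
  have hcomp (n : ℕ) (x : M) :
      partialComp (N := fun _ => M) (fun n => s (g n)) n (g₀ x) = g n x := by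
    induction n with
    | zero => rfl
    | succ n ih => rw [partialComp, LinearMap.comp_apply, ih]; rfl
  obtain ⟨n, t, ht⟩ := h (F.image g₀) fun n => s (g n)
  obtain ⟨x, hx, hne⟩ := hs (g n) (hgS n) t
  exact hne (by simpa only [hcomp] using ht (g₀ x) (Finset.mem_image_of_mem _ hx))

theorem HasStableOrbits.exists_mem_submonoid (h : HasStableOrbits A M)
    (K : Submonoid (Module.End A M)) (F : Finset M) (q : Module.End A M) :
    ∃ p ∈ K, ∀ p' ∈ K, ∃ t : Module.End A M, ∀ x ∈ F, t (p' (p (q x))) = p (q x) := by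
  obtain ⟨_, ⟨p, hp, rfl⟩, hstable⟩ :=
    h.exists_mem_forall_mul_mem (S := (· * q) '' K) ⟨_, 1, K.one_mem, rfl⟩ F
  exact ⟨p, hp, fun p' hp' => hstable p' ⟨p' * p, K.mul_mem hp' hp, mul_assoc _ _ _⟩⟩

end StableOrbits

section CountablyGenerated

variable {A : Type*} [Ring A] {M : Type*} [AddCommGroup M] [Module A M]
  {M' : Type*} [AddCommGroup M'] [Module A M']

theorem IsCountablyGenerated.of_surjective (h : IsCountablyGenerated A M) (π : M →ₗ[A] M')
    (hπ : Function.Surjective π) : IsCountablyGenerated A M' := by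
  obtain ⟨s, hs, hspan⟩ := h
  exact ⟨π '' s, hs.image π, by
    rw [Submodule.span_image, hspan, Submodule.map_top, LinearMap.range_eq_top.2 hπ]⟩

theorem IsCountablyGenerated.exists_monotone_iSup_span_eq_top (h : IsCountablyGenerated A M) :
    ∃ F : ℕ → Finset M, Monotone F ∧ ⨆ k, Submodule.span A (F k : Set M) = ⊤ := by
  classical
  obtain ⟨s, hs, hspan⟩ := h
  obtain ⟨x, hx⟩ := (hs.insert 0).exists_eq_range (Set.insert_nonempty 0 s)
  refine ⟨fun k => (Finset.range k).image x,
    fun i j hij => Finset.image_subset_image (Finset.range_mono hij), ?_⟩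
  rw [eq_top_iff, ← hspan, Submodule.span_le]
  intro y hy
  obtain ⟨k, rfl⟩ : y ∈ Set.range x := hx ▸ Set.mem_insert_of_mem 0 hy
  exact Submodule.mem_iSup_of_mem (k + 1)
    (Submodule.subset_span (Finset.mem_image_of_mem x (Finset.self_mem_range_succ k)))

theorem exists_mem_subset_of_finset_subset_sSup {c : Set (Submodule A M)} (hne : c.Nonempty)
    (hdir : DirectedOn (· ≤ ·) c) {F : Finset M}
    (hF : (F : Set M) ⊆ (sSup c : Submodule A M)) :
    ∃ P ∈ c, (F : Set M) ⊆ P := by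
  have hcompact := (Submodule.fg_iff_compact _).1 (Submodule.fg_span (R := A) F.finite_toSet)
  obtain ⟨P, hP, hFP⟩ := hcompact c (sSup c) hne hdir (isLUB_sSup c) (Submodule.span_le.2 hF)
  exact ⟨P, hP, Submodule.span_le.1 hFP⟩

theorem exists_linearMap_eqOn_of_directed {ι : Type*} [Preorder ι] [IsDirectedOrder ι] [Nonempty ι]
    {S : ι → Submodule A M} (hS : Monotone S) (htop : ⨆ i, S i = ⊤) (f : ι → M →ₗ[A] M')
    (hf : ∀ i j, i ≤ j → Set.EqOn (f j) (f i) (S i)) :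
    ∃ g : M →ₗ[A] M', ∀ i, Set.EqOn g (f i) (S i) := by
  let p (i : ι) : M →ₗ.[A] M' := (f i).toPMap (S i)
  have hp : Monotone p := fun i j hij => ⟨hS hij, fun x y hxy =>
    (hf i j hij x.2).symm.trans (congrArg (f j) hxy)⟩
  have hdir : DirectedOn (· ≤ ·) (Set.range p) := hp.directed_le.directedOn_range
  let P : M →ₗ.[A] M' := LinearPMap.sSup _ hdir
  have hdom (x : M) : x ∈ P.domain := by
    have hrange : LinearPMap.domain '' Set.range p = Set.range S := by
      rw [← Set.range_comp]
      rfl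
    rw [LinearPMap.domain_sSup, hrange, sSup_range, htop]
    trivial
  exact ⟨P.toFun ∘ₗ LinearMap.id.codRestrict P.domain hdom, fun i x hx =>
    LinearPMap.sSup_apply hdir ⟨i, rfl⟩ ⟨x, hx⟩⟩

end CountablyGenerated

section MinimalOrbits

variable {A : Type*} [Ring A] {M : Type*} [AddCommGroup M] [Module A M]
  {K : Submonoid (Module.End A M)}

/-- The orbit of the tuple `(q x)_{x ∈ F}` under the monoid `K` is minimal: it is contained in the
orbit of each of its members. -/
def IsMinimalOn (K : Submonoid (Module.End A M)) (F : Set M) (q : Module.End A M) : Prop :=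
  ∀ p ∈ K, ∃ t ∈ K, ∀ x ∈ F, t (p (q x)) = q x

theorem IsMinimalOn.mono {F G : Set M} {q : Module.End A M} (h : IsMinimalOn K G q) (hFG : F ⊆ G) :
    IsMinimalOn K F q := fun p hp =>
  let ⟨t, ht, hx⟩ := h p hp
  ⟨t, ht, fun x hxF => hx x (hFG hxF)⟩

theorem IsMinimalOn.congr {F : Set M} {q q' : Module.End A M} (h : IsMinimalOn K F q)
    (hq : Set.EqOn q' q F) : IsMinimalOn K F q' := fun p hp =>
  let ⟨t, ht, hx⟩ := h p hp
  ⟨t, ht, fun x hxF => by rw [hq hxF, hx x hxF]⟩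

theorem IsMinimalOn.span {F : Set M} {q : Module.End A M} (h : IsMinimalOn K F q) :
    IsMinimalOn K (Submodule.span A F) q := fun p hp =>
  let ⟨t, ht, hx⟩ := h p hp
  ⟨t, ht, LinearMap.eqOn_span' (f := t * p * q) hx⟩

theorem IsMinimalOn.mul_left {F : Set M} {q w : Module.End A M} (h : IsMinimalOn K F q)
    (hw : w ∈ K) : IsMinimalOn K F (w * q) := fun p hp =>
  let ⟨t, ht, hx⟩ := h (p * w) (K.mul_mem hp hw)
  ⟨w * t, K.mul_mem hw ht, fun x hxF => congrArg w (hx x hxF)⟩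

theorem IsMinimalOn.exists_eqOn {F G : Set M} {q : Module.End A M} (hq : q ∈ K)
    (h : IsMinimalOn K F q) (hG : ∃ p ∈ K, IsMinimalOn K G (p * q)) :
    ∃ q' ∈ K, IsMinimalOn K G q' ∧ Set.EqOn q' q F := by
  obtain ⟨p, hp, hpG⟩ := hG
  obtain ⟨t, ht, htp⟩ := h p hp
  exact ⟨t * (p * q), K.mul_mem ht (K.mul_mem hp hq), hpG.mul_left ht, htp⟩

/-- A monoid of endomorphisms is finitely closed if it is closed in the finite topology, that is,
if it contains each endomorphism which agrees on every finite set with a member of the monoid. -/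
def IsFinitelyClosed (K : Submonoid (Module.End A M)) : Prop :=
  ∀ u : Module.End A M, (∀ F : Finset M, ∃ q ∈ K, Set.EqOn u q F) → u ∈ K

theorem exists_forall_isMinimalOn (hM : IsCountablyGenerated A M) (hK : IsFinitelyClosed K)
    (hmin : ∀ F : Finset M, ∀ q ∈ K, ∃ p ∈ K, IsMinimalOn K F (p * q)) :
    ∃ u ∈ K, ∀ F : Finset M, IsMinimalOn K F u := by
  obtain ⟨F, hF, htop⟩ := hM.exists_monotone_iSup_span_eq_top
  let S (k : ℕ) : Submodule A M := Submodule.span A (F k)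
  have hS : Monotone S := fun i j hij => Submodule.span_mono (Finset.coe_subset.2 (hF hij))
  let Approx (k : ℕ) := {q : Module.End A M // q ∈ K ∧ IsMinimalOn K (F k) q}
  have hstart : Nonempty (Approx 0) :=
    let ⟨p, hp, h⟩ := hmin (F 0) 1 K.one_mem
    ⟨p * 1, K.mul_mem hp K.one_mem, h⟩
  have hstep (k : ℕ) (q : Approx k) : ∃ q' : Approx (k + 1), Set.EqOn q'.1 q.1 (F k) :=
    let ⟨q', hq', h, heq⟩ := q.2.2.exists_eqOn q.2.1 (hmin (F (k + 1)) q q.2.1)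
    ⟨⟨q', hq', h⟩, heq⟩
  choose next hnext using hstep
  let q (k : ℕ) : Approx k := Nat.rec hstart.some next k
  have hq (i j : ℕ) (hij : i ≤ j) : Set.EqOn (q j).1 (q i).1 (S i) := by
    induction j, hij using Nat.le_induction with
    | base => exact fun _ _ => rfl
    | succ j hij ih =>
      exact fun x hx => (LinearMap.eqOn_span' (hnext j (q j)) (hS hij hx)).trans (ih hx)
  obtain ⟨u, hu⟩ := exists_linearMap_eqOn_of_directed hS htop (fun k => (q k).1) hq
  have hcover (G : Finset M) : ∃ k, (G : Set M) ⊆ S k := by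
    obtain ⟨_, ⟨k, rfl⟩, hk⟩ := exists_mem_subset_of_finset_subset_sSup (Set.range_nonempty S)
      hS.directed_le.directedOn_range (F := G) (by simp [sSup_range, S, htop])
    exact ⟨k, hk⟩
  refine ⟨u, hK u fun G => ?_, fun G => ?_⟩ <;> obtain ⟨k, hk⟩ := hcover G
  · exact ⟨(q k).1, (q k).2.1, (hu k).mono hk⟩
  · exact ((q k).2.2.span.congr (hu k)).mono hk

end MinimalOrbits

section LocallySplit

variable {A : Type*} [Ring A] {M : Type*} [AddCommGroup M] [Module A M] {P : Submodule A M}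
  {M' : Type*} [AddCommGroup M'] [Module A M']

/-- A submodule `P` of `M` is locally split if each finite subset of `P` is fixed pointwise by
an endomorphism of `M` with values in `P`. -/
def IsLocallySplit (P : Submodule A M) : Prop :=
  ∀ F : Finset M, (F : Set M) ⊆ P → ∃ r : Module.End A M, (∀ x, r x ∈ P) ∧ ∀ x ∈ F, r x = x

theorem isLocallySplit_of_isComplemented (h : IsComplemented P) : IsLocallySplit P := by
  obtain ⟨Q, hPQ⟩ := h
  exact fun F hF => ⟨P.projection Q hPQ, fun x => Submodule.projection_apply_mem hPQ x,
    fun x hx => Submodule.projection_apply_left hPQ ⟨x, hF hx⟩⟩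

theorem isLocallySplit_sSup_of_directedOn {c : Set (Submodule A M)} (hne : c.Nonempty)
    (hdir : DirectedOn (· ≤ ·) c) (hc : ∀ P ∈ c, IsLocallySplit P) : IsLocallySplit (sSup c) := by
  intro F hF
  obtain ⟨P, hP, hFP⟩ := exists_mem_subset_of_finset_subset_sSup hne hdir hF
  obtain ⟨r, hr, hrF⟩ := hc P hP F hFP
  exact ⟨r, fun x => le_sSup hP (hr x), hrF⟩

theorem isLocallySplit_range {f : M →ₗ[A] M'}
    (hf : ∀ F : Finset M, ∃ t : M' →ₗ[A] M, ∀ x ∈ F, t (f x) = x) :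
    IsLocallySplit (LinearMap.range f) := by
  classical
  intro F hF
  rw [LinearMap.coe_range, ← Set.image_univ] at hF
  obtain ⟨G, -, rfl⟩ := Finset.subset_set_image_iff.1 hF
  obtain ⟨t, ht⟩ := hf G
  refine ⟨f ∘ₗ t, fun x => LinearMap.mem_range_self f (t x), ?_⟩
  rintro _ hx
  obtain ⟨z, hz, rfl⟩ := Finset.mem_image.1 hx
  exact congrArg f (ht z hz)

/-- The monoid of endomorphisms which are congruent to the identity modulo `P`. -/
def congruentToOne (P : Submodule A M) : Submonoid (Module.End A M) where
  carrier := {q | ∀ x, x - q x ∈ P}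
  one_mem' x := by simp
  mul_mem' {a b} ha hb x := by
    simpa using P.add_mem (ha (b x)) (hb x)

theorem apply_mem_of_mem_congruentToOne {q : Module.End A M} (hq : q ∈ congruentToOne P) {x : M}
    (hx : x ∈ P) : q x ∈ P :=
  (P.sub_mem_iff_right hx).1 (hq x)

theorem isFinitelyClosed_congruentToOne (P : Submodule A M) :
    IsFinitelyClosed (congruentToOne P) := by
  intro u hu x
  obtain ⟨q, hq, hqx⟩ := hu {x}
  rw [hqx (Finset.mem_coe.2 (Finset.mem_singleton_self x))]
  exact hq x

theorem IsLocallySplit.exists_mem_congruentToOne_apply_eq_zero (h : IsLocallySplit P) {F : Finset M}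
    (hF : (F : Set M) ⊆ P) : ∃ p ∈ congruentToOne P, ∀ x ∈ F, p x = 0 := by
  obtain ⟨r, hr, hrF⟩ := h F hF
  exact ⟨1 - r, fun x => by simpa using hr x, fun x hx => by simp [hrF x hx]⟩

theorem IsLocallySplit.exists_isMinimalOn_mul (h : IsLocallySplit P) (hS : HasStableOrbits A M)
    (F : Finset M) {q : Module.End A M} (hq : q ∈ congruentToOne P) :
    ∃ p ∈ congruentToOne P, IsMinimalOn (congruentToOne P) F (p * q) := by
  classical
  obtain ⟨p, hp, hstable⟩ := hS.exists_mem_submonoid (congruentToOne P) F q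
  refine ⟨p, hp, fun p' hp' => ?_⟩
  let g : Module.End A M := p * q
  have hg : g ∈ congruentToOne P := mul_mem hp hq
  obtain ⟨r, hr, hrF⟩ := h.exists_mem_congruentToOne_apply_eq_zero
      (F := F.image fun x => p' (g (x - g x))) fun z hz => by
    obtain ⟨x, -, rfl⟩ := Finset.mem_image.1 (Finset.mem_coe.1 hz)
    exact apply_mem_of_mem_congruentToOne hp' (apply_mem_of_mem_congruentToOne hg (hg x))
  obtain ⟨t, ht⟩ := hstable (r * p') (mul_mem hr hp')
  -- `t` undoes `r * p'` on `g F` but need not be congruent to `1`; this correction of it is.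
  let t' : Module.End A M := 1 + (1 - r * p' * g) * t
  have ht' : t' ∈ congruentToOne P := fun x => by
    simpa [t'] using P.neg_mem (mul_mem (mul_mem hr hp') hg (t x))
  refine ⟨t' * r, mul_mem ht' hr, fun x hx => ?_⟩
  have hundo : t (r (p' (g x))) = g x := ht x hx
  have hkill : r (p' (g x)) = r (p' (g (g x))) := by
    simpa only [map_sub, sub_eq_zero] using hrF _ (Finset.mem_image_of_mem _ hx)
  change t' (r (p' (g x))) = g x
  simp [t', hundo, ← hkill]

theorem IsLocallySplit.isComplemented (h : IsLocallySplit P) (hM : IsCountablyGenerated A M)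
    (hS : HasStableOrbits A M) : IsComplemented P := by
  obtain ⟨u, hu, hmin⟩ := exists_forall_isMinimalOn hM (isFinitelyClosed_congruentToOne P)
    fun F q hq => h.exists_isMinimalOn_mul hS F hq
  have hker : P = LinearMap.ker u := by
    ext z
    refine ⟨fun hz => ?_, fun hz => by simpa [LinearMap.mem_ker.1 hz] using hu z⟩
    obtain ⟨p, hp, hpz⟩ := h.exists_mem_congruentToOne_apply_eq_zero (F := {u z})
      (by simpa using apply_mem_of_mem_congruentToOne hu hz)
    obtain ⟨t, -, ht⟩ := hmin {z} p hp
    rw [LinearMap.mem_ker, ← ht z (by simp), hpz _ (by simp), map_zero]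
  have hidem : IsIdempotentElem u := LinearMap.ext fun x => by
    have hx : x - u x ∈ LinearMap.ker u := hker ▸ hu x
    rw [LinearMap.mem_ker, map_sub, sub_eq_zero] at hx
    exact hx.symm
  exact ⟨LinearMap.range u, hker ▸ (LinearMap.IsIdempotentElem.isCompl hidem).symm⟩

theorem isComplemented_sSup_of_directedOn (hM : IsCountablyGenerated A M)
    (hS : HasStableOrbits A M) {c : Set (Submodule A M)} (hne : c.Nonempty)
    (hdir : DirectedOn (· ≤ ·) c) (hc : ∀ P ∈ c, IsComplemented P) : IsComplemented (sSup c) :=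
  (isLocallySplit_sSup_of_directedOn hne hdir fun P hP =>
    isLocallySplit_of_isComplemented (hc P hP)).isComplemented hM hS

theorem IsCountablyGenerated.of_isComplemented (hM : IsCountablyGenerated A M)
    (hP : IsComplemented P) : IsCountablyGenerated A P :=
  let ⟨Q, hPQ⟩ := hP
  hM.of_surjective (P.projectionOnto Q hPQ) (Submodule.projectionOnto_surjective hPQ)

theorem HasStableOrbits.of_isComplemented (hS : HasStableOrbits A M) (hP : IsComplemented P) :
    HasStableOrbits A P :=
  let ⟨Q, hPQ⟩ := hP
  hS.of_leftInverse P.subtype (P.projectionOnto Q hPQ) (Submodule.projectionOnto_apply_left hPQ)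

end LocallySplit

section Indecomposable

variable {A : Type*} [Ring A] {N : Type*} [AddCommGroup N] [Module A N]
  {N' : Type*} [AddCommGroup N'] [Module A N']

variable (A N) in
/-- A module is indecomposable if it is nonzero and is not the direct sum of two nonzero
submodules. -/
structure IsIndecomposable : Prop where
  nontrivial : Nontrivial N
  eq_bot_or_eq_bot : ∀ P Q : Submodule A N, IsCompl P Q → P = ⊥ ∨ Q = ⊥

theorem IsIndecomposable.of_linearEquiv (h : IsIndecomposable A N) (e : N ≃ₗ[A] N') :
    IsIndecomposable A N' := by
  have := h.nontrivial
  refine ⟨e.symm.toEquiv.nontrivial, fun P Q hPQ => ?_⟩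
  let E : Submodule A N' ≃o Submodule A N := Submodule.orderIsoMapComap e.symm
  simpa only [map_eq_bot_iff] using h.eq_bot_or_eq_bot (E P) (E Q) (E.isCompl hPQ)

theorem IsIndecomposable.bijective_of_locally_leftInverse [Nontrivial N]
    (h : IsIndecomposable A N') (hN' : IsCountablyGenerated A N') (hS : HasStableOrbits A N')
    {f : N →ₗ[A] N'} (hf : ∀ F : Finset N, ∃ t : N' →ₗ[A] N, ∀ x ∈ F, t (f x) = x) :
    Function.Bijective f := by
  have hinj : Function.Injective f := (injective_iff_map_eq_zero f).2 fun x hx => by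
    obtain ⟨t, ht⟩ := hf {x}
    rw [← ht x (Finset.mem_singleton_self x), hx, map_zero]
  obtain ⟨Q, hQ⟩ := (isLocallySplit_range hf).isComplemented hN' hS
  refine ⟨hinj, LinearMap.range_eq_top.1 ?_⟩
  rcases h.eq_bot_or_eq_bot _ _ hQ with hrange | rfl
  · obtain ⟨x, hx⟩ := exists_ne (0 : N)
    rw [LinearMap.range_eq_bot.1 hrange] at hinj
    exact absurd (hinj (a₁ := x) (a₂ := 0) rfl) hx
  · exact eq_top_of_isCompl_bot hQ

theorem isCompl_sup_map_subtype {P D : Submodule A N} {P' Q' : Submodule A D} (h : IsCompl P D)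
    (h' : IsCompl P' Q') : IsCompl (P ⊔ P'.map D.subtype) (Q'.map D.subtype) := by
  have hsup : P'.map D.subtype ⊔ Q'.map D.subtype = D := by
    rw [← Submodule.map_sup, h'.sup_eq_top, Submodule.map_subtype_top]
  refine (Submodule.disjoint_map D.injective_subtype h'.disjoint)
    |>.isCompl_sup_left_of_isCompl_sup_right ?_
  rwa [hsup]

theorem exists_maximal_isComplemented_notMem (hN : IsCountablyGenerated A N)
    (hS : HasStableOrbits A N) {y : N} (hy : y ≠ 0) :
    ∃ P : Submodule A N, Maximal (fun P => IsComplemented P ∧ y ∉ P) P := by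
  have hchains : ∀ c ⊆ {P : Submodule A N | IsComplemented P ∧ y ∉ P}, IsChain (· ≤ ·) c →
      ∀ Q ∈ c, ∃ B ∈ {P : Submodule A N | IsComplemented P ∧ y ∉ P}, ∀ P ∈ c, P ≤ B := by
    intro c hc hchain Q hQ
    refine ⟨sSup c, ⟨isComplemented_sSup_of_directedOn hN hS ⟨Q, hQ⟩ hchain.directedOn
      fun P hP => (hc hP).1, fun hyc => ?_⟩, fun P hP => le_sSup hP⟩
    obtain ⟨P, hP, hyP⟩ := (Submodule.mem_sSup_of_directed ⟨Q, hQ⟩ hchain.directedOn).1 hyc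
    exact (hc hP).2 hyP
  obtain ⟨P, -, hP⟩ :=
    zorn_le_nonempty₀ _ hchains ⊥ ⟨isComplemented_bot, mt (Submodule.mem_bot A).1 hy⟩
  exact ⟨P, hP⟩

theorem mem_sup_map_subtype_of_maximal {P D : Submodule A N} {y : N}
    (hP : Maximal (fun P => IsComplemented P ∧ y ∉ P) P) (hPD : IsCompl P D)
    {P' Q' : Submodule A D} (h : IsCompl P' Q') (hne : P' ≠ ⊥) : y ∈ P ⊔ P'.map D.subtype := by
  by_contra hy
  have hle : P'.map D.subtype ≤ P :=
    le_sup_right.trans (hP.2 ⟨⟨_, isCompl_sup_map_subtype hPD h⟩, hy⟩ le_sup_left)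
  have hbot : P'.map D.subtype = ⊥ :=
    le_bot_iff.1 (hPD.disjoint hle (Submodule.map_subtype_le D P'))
  exact hne (Submodule.map_injective_of_injective D.injective_subtype
    (hbot.trans (Submodule.map_bot _).symm))

theorem isIndecomposable_of_maximal {P D : Submodule A N} {y : N}
    (hP : Maximal (fun P => IsComplemented P ∧ y ∉ P) P) (hPD : IsCompl P D) :
    IsIndecomposable A D := by
  refine ⟨(Submodule.nontrivial_iff_ne_bot).2 ?_, fun P' Q' h => ?_⟩
  · rintro rfl
    exact hP.1.2 (eq_top_of_isCompl_bot hPD ▸ Submodule.mem_top)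
  · by_contra! hne
    have hyP' := mem_sup_map_subtype_of_maximal hP hPD h hne.1
    have hyQ' := mem_sup_map_subtype_of_maximal hP hPD h.symm hne.2
    have hinf : (P ⊔ P'.map D.subtype) ⊓ (P ⊔ Q'.map D.subtype) = P := by
      rw [inf_comm, sup_inf_assoc_of_le _ le_sup_left,
        (isCompl_sup_map_subtype hPD h).symm.inf_eq_bot, sup_bot_eq]
    exact hP.1.2 (hinf.le ⟨hyP', hyQ'⟩)

theorem exists_isCompl_isIndecomposable [Nontrivial N] (hN : IsCountablyGenerated A N)
    (hS : HasStableOrbits A N) : ∃ P D : Submodule A N, IsCompl P D ∧ IsIndecomposable A D := by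
  obtain ⟨y, hy⟩ := exists_ne (0 : N)
  obtain ⟨P, hP⟩ := exists_maximal_isComplemented_notMem hN hS hy
  obtain ⟨D, hPD⟩ := hP.1.1
  exact ⟨P, D, hPD, isIndecomposable_of_maximal hP hPD⟩

end Indecomposable

section Fitting

variable {A : Type*} [Ring A] {N : Type*} [AddCommGroup N] [Module A N]

/-- An endomorphism is locally nilpotent if each element is annihilated by one of its powers. -/
def IsLocallyNilpotent (w : Module.End A N) : Prop :=
  ∀ x, ∃ n, (w ^ n) x = 0

theorem isLocallyNilpotent_iff_iSup_iterateKer_eq_top {w : Module.End A N} :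
    IsLocallyNilpotent w ↔ ⨆ n, LinearMap.iterateKer w n = ⊤ := by
  simp only [Submodule.eq_top_iff', Submodule.mem_iSup_of_chain]
  rfl

theorem IsLocallyNilpotent.isUnit_one_sub {w : Module.End A N} (h : IsLocallyNilpotent w) :
    IsUnit (1 - w) := by
  refine (Module.End.isUnit_iff _).2 ⟨(injective_iff_map_eq_zero _).2 fun x hx => ?_, fun x => ?_⟩
  · obtain ⟨n, hn⟩ := h x
    have hsum := LinearMap.congr_fun (geom_sum_mul_neg w n) x
    rwa [Module.End.mul_apply, hx, map_zero, LinearMap.sub_apply, hn, sub_zero, eq_comm] at hsum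
  · obtain ⟨n, hn⟩ := h x
    have hsum := LinearMap.congr_fun (mul_neg_geom_sum w n) x
    rw [Module.End.mul_apply, LinearMap.sub_apply 1 (w ^ n), hn, sub_zero] at hsum
    exact ⟨_, hsum⟩

theorem HasStableOrbits.isLocallyNilpotent (h : HasStableOrbits A N) {w : Module.End A N}
    (hw : ∀ t : Module.End A N, IsUnit (1 - t * w)) : IsLocallyNilpotent w := by
  intro x
  obtain ⟨_, ⟨n, rfl⟩, hstable⟩ :=
    h.exists_mem_forall_mul_mem (S := Set.range fun n => w ^ n) ⟨_, 0, rfl⟩ {x}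
  obtain ⟨t, ht⟩ := hstable w ⟨n + 1, pow_succ' w n⟩
  have hfixed : t (w ((w ^ n) x)) = (w ^ n) x := ht x (Finset.mem_singleton_self x)
  refine ⟨n, ((Module.End.isUnit_iff _).1 (hw t)).injective ?_⟩
  rw [map_zero, LinearMap.sub_apply, Module.End.mul_apply, hfixed, Module.End.one_apply, sub_self]

theorem exists_commute_mul_pow_add_mul_pow_eq_one {R : Type*} [Ring R] (u : R) (m n : ℕ) :
    ∃ a b : R, Commute a u ∧ Commute b u ∧ a * u ^ m + b * (1 - u) ^ n = 1 := by
  have hcop : IsCoprime (Polynomial.X : Polynomial ℤ) (1 - Polynomial.X) := ⟨1, 1, by ring⟩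
  obtain ⟨a, b, hab⟩ := hcop.pow (m := m) (n := n)
  refine ⟨Polynomial.aeval u a, Polynomial.aeval u b, ?_, ?_, ?_⟩
  · simpa using (Commute.all a Polynomial.X).map (Polynomial.aeval u)
  · simpa using (Commute.all b Polynomial.X).map (Polynomial.aeval u)
  · simpa using congrArg (Polynomial.aeval u) hab

theorem isCompl_iSup_iterateKer {u : Module.End A N} (hu : IsLocallyNilpotent (u * (1 - u))) :
    IsCompl (⨆ n, LinearMap.iterateKer u n) (⨆ n, LinearMap.iterateKer (1 - u) n) := by
  have hcomm : Commute u (1 - u) := (Commute.one_right u).sub_right (Commute.refl u)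
  refine ⟨Submodule.disjoint_def.2 fun x hx hx' => ?_, codisjoint_iff.2 ?_⟩
  · obtain ⟨m, hm⟩ := (Submodule.mem_iSup_of_chain _ _).1 hx
    obtain ⟨n, hn⟩ := (Submodule.mem_iSup_of_chain _ _).1 hx'
    obtain ⟨a, b, -, -, hab⟩ := exists_commute_mul_pow_add_mul_pow_eq_one u m n
    have hm : (u ^ m) x = 0 := hm
    have hn : ((1 - u) ^ n) x = 0 := hn
    simpa [hm, hn] using (LinearMap.congr_fun hab x).symm
  · refine Submodule.eq_top_iff'.2 fun x => ?_
    obtain ⟨n, hn⟩ := hu x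
    obtain ⟨a, b, ha, hb, hab⟩ := exists_commute_mul_pow_add_mul_pow_eq_one u n n
    have hx : (b * (1 - u) ^ n) x + (a * u ^ n) x = x := by
      rw [add_comm]
      exact LinearMap.congr_fun hab x
    rw [← hx]
    refine Submodule.add_mem_sup (Submodule.mem_iSup_of_mem n ?_) (Submodule.mem_iSup_of_mem n ?_)
    · have hkill : u ^ n * (b * (1 - u) ^ n) = b * (u * (1 - u)) ^ n := by
        rw [(hb.pow_right n).symm.left_comm, hcomm.mul_pow]
      exact (LinearMap.congr_fun hkill x).trans ((congrArg b hn).trans (map_zero b))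
    · have ha' : Commute a (1 - u) := (Commute.one_right a).sub_right ha
      have hkill : (1 - u) ^ n * (a * u ^ n) = a * (u * (1 - u)) ^ n := by
        rw [(ha'.pow_right n).symm.left_comm, hcomm.mul_pow, (hcomm.pow_pow n n).eq]
      exact (LinearMap.congr_fun hkill x).trans ((congrArg a hn).trans (map_zero a))

theorem IsIndecomposable.isUnit_or_isUnit_one_sub (h : IsIndecomposable A N) {u : Module.End A N}
    (hu : IsLocallyNilpotent (u * (1 - u))) : IsUnit u ∨ IsUnit (1 - u) := by
  have hcompl := isCompl_iSup_iterateKer hu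
  rcases h.eq_bot_or_eq_bot _ _ hcompl with hbot | hbot <;> rw [hbot] at hcompl
  · have hnil := isLocallyNilpotent_iff_iSup_iterateKer_eq_top.2 (eq_top_of_bot_isCompl hcompl)
    exact .inl (by simpa using hnil.isUnit_one_sub)
  · have hnil := isLocallyNilpotent_iff_iSup_iterateKer_eq_top.2 (eq_top_of_isCompl_bot hcompl)
    exact .inr hnil.isUnit_one_sub

end Fitting

section FixedElements

variable {A : Type*} [Ring A] {N : Type*} [AddCommGroup N] [Module A N]
  {N' : Type*} [AddCommGroup N'] [Module A N']

theorem isFinitelyClosed_stabilizerSubmonoid (y : N) :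
    IsFinitelyClosed (MulAction.stabilizerSubmonoid (Module.End A N) y) := by
  intro u hu
  obtain ⟨q, hq, huq⟩ := hu {y}
  exact (huq (Finset.mem_coe.2 (Finset.mem_singleton_self y))).trans hq

theorem HasStableOrbits.exists_isMinimalOn_stabilizerSubmonoid (h : HasStableOrbits A N) (y : N)
    (F : Finset N) {q : Module.End A N}
    (hq : q ∈ MulAction.stabilizerSubmonoid (Module.End A N) y) :
    ∃ p ∈ MulAction.stabilizerSubmonoid (Module.End A N) y,
      IsMinimalOn (MulAction.stabilizerSubmonoid (Module.End A N) y) F (p * q) := by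
  classical
  obtain ⟨p, hp, hstable⟩ :=
    h.exists_mem_submonoid (MulAction.stabilizerSubmonoid (Module.End A N) y) (insert y F) q
  refine ⟨p, hp, fun p' hp' => ?_⟩
  obtain ⟨t, ht⟩ := hstable p' hp'
  refine ⟨t, ?_, fun x hx => ht x (Finset.mem_insert_of_mem hx)⟩
  have hpq : p (q y) = y := mul_mem hp hq
  have hp'y : p' y = y := hp'
  have hty := ht y (Finset.mem_insert_self y F)
  rwa [hpq, hp'y] at hty

theorem IsIndecomposable.isUnit_one_sub_mul (h : IsIndecomposable A N)
    (hN : IsCountablyGenerated A N) (hS : HasStableOrbits A N) {y : N} {u : Module.End A N}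
    (hu : ∀ F : Finset N, IsMinimalOn (MulAction.stabilizerSubmonoid (Module.End A N) y) F u)
    {s : Module.End A N} (hs : s y = 0) : IsUnit (1 - s * u) := by
  have := h.nontrivial
  refine (Module.End.isUnit_iff _).2 (h.bijective_of_locally_leftInverse hN hS fun F => ?_)
  obtain ⟨t, -, ht⟩ := hu F (1 - u * s) (by simp [MulAction.mem_stabilizerSubmonoid_iff, hs])
  -- If `t` inverts `1 - u * s` then `1 + s * t * u` inverts `1 - s * u`.
  refine ⟨1 + s * t * u, fun x hx => ?_⟩
  have hundo : t (u x - u (s (u x))) = u x := ht x hx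
  simp only [LinearMap.add_apply, LinearMap.sub_apply, Module.End.mul_apply, Module.End.one_apply,
    map_sub u, hundo, sub_add_cancel]

theorem IsIndecomposable.isUnit_of_apply_eq_self (h : IsIndecomposable A N)
    (hN : IsCountablyGenerated A N) (hS : HasStableOrbits A N) {y : N} (hy : y ≠ 0)
    {t : Module.End A N} (ht : t y = y) : IsUnit t := by
  obtain ⟨u, huy, hmin⟩ := exists_forall_isMinimalOn hN (isFinitelyClosed_stabilizerSubmonoid y)
    fun F q hq => hS.exists_isMinimalOn_stabilizerSubmonoid y F hq
  have huy : u y = y := huy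
  have hradical {s : Module.End A N} (hs : s y = 0) : IsUnit (1 - s * u) :=
    h.isUnit_one_sub_mul hN hS hmin hs
  have hnil : IsLocallyNilpotent (u * (1 - u)) := hS.isLocallyNilpotent fun s => by
    have hunit := hradical (s := s * (1 - u)) (by simp [huy])
    rwa [mul_assoc, sub_mul, one_mul, ← mul_one_sub] at hunit
  have hu : IsUnit u := (h.isUnit_or_isUnit_one_sub hnil).resolve_right fun hunit =>
    hy (((Module.End.isUnit_iff _).1 hunit).injective (by simp [huy]))
  obtain ⟨v, rfl⟩ := hu
  have hvy : (↑v⁻¹ : Module.End A N) y = y := by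
    simpa only [Module.End.mul_apply, huy, Module.End.one_apply] using
      LinearMap.congr_fun v.inv_mul y
  simpa using hradical (s := (1 - t) * ↑v⁻¹) (by simp [hvy, ht])

theorem IsIndecomposable.bijective_of_apply_apply_eq_self (h : IsIndecomposable A N)
    (hN : IsCountablyGenerated A N) (hS : HasStableOrbits A N) (h' : IsIndecomposable A N')
    (hN' : IsCountablyGenerated A N') (hS' : HasStableOrbits A N') {f : N →ₗ[A] N'}
    {t : N' →ₗ[A] N} {y : N} (hy : y ≠ 0) (hty : t (f y) = y) : Function.Bijective f := by
  have := h.nontrivial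
  obtain ⟨v, hv⟩ := h.isUnit_of_apply_eq_self hN hS hy (t := t ∘ₗ f) hty
  refine h'.bijective_of_locally_leftInverse hN' hS' fun _ => ⟨↑v⁻¹ ∘ₗ t, fun x _ => ?_⟩
  exact LinearMap.congr_fun (hv ▸ v.inv_mul : ↑v⁻¹ * (t ∘ₗ f) = 1) x

end FixedElements

section Decomposition

variable {A : Type*} [Ring A] {M : Type*} [AddCommGroup M] [Module A M]

theorem sSupIndep_insert {α : Type*} [CompleteLattice α] [IsModularLattice α] {s : Set α}
    (hs : sSupIndep s) {a : α} (ha : Disjoint (sSup s) a) : sSupIndep (insert a s) := by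
  intro b hb
  rcases eq_or_ne b a with rfl | hne
  · exact ha.symm.mono_right (sSup_le_sSup (by simp))
  · have hbs : b ∈ s := hb.resolve_left hne
    have hle : sSup (insert a s \ {b}) ≤ sSup (s \ {b}) ⊔ a := by
      rw [sup_comm, ← sSup_insert]
      exact sSup_le_sSup Set.insert_sdiff_subset
    exact ((hs hbs).disjoint_sup_right_of_disjoint_sup_left
      (ha.mono_left (sup_le (le_sSup hbs) (sSup_le_sSup Set.sdiff_subset)))).mono_right hle

/-- A partial decomposition of a module is an independent set of indecomposable submodules whose
sum is a direct summand. -/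
structure IsPartialDecomposition (s : Set (Submodule A M)) : Prop where
  independent : sSupIndep s
  isIndecomposable : ∀ D ∈ s, IsIndecomposable A D
  isComplemented_sSup : IsComplemented (sSup s)

theorem isPartialDecomposition_sUnion (hM : IsCountablyGenerated A M) (hS : HasStableOrbits A M)
    {c : Set (Set (Submodule A M))} (hne : c.Nonempty) (hdir : DirectedOn (· ⊆ ·) c)
    (hc : ∀ s ∈ c, IsPartialDecomposition s) : IsPartialDecomposition (⋃₀ c) := by
  refine ⟨iSupIndep_sUnion_of_directed hdir fun s hs => (hc s hs).independent, ?_, ?_⟩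
  · rintro D ⟨s, hs, hD⟩
    exact (hc s hs).isIndecomposable D hD
  · rw [sSup_sUnion, ← sSup_image]
    refine isComplemented_sSup_of_directedOn hM hS (hne.image _)
      (directedOn_image.2 (hdir.mono fun _ _ => sSup_le_sSup)) ?_
    rintro _ ⟨s, hs, rfl⟩
    exact (hc s hs).isComplemented_sSup

theorem IsPartialDecomposition.exists_ssubset {s : Set (Submodule A M)}
    (hs : IsPartialDecomposition s) (hM : IsCountablyGenerated A M) (hS : HasStableOrbits A M)
    (htop : sSup s ≠ ⊤) : ∃ s', s ⊂ s' ∧ IsPartialDecomposition s' := by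
  obtain ⟨hind, hindec, R, hR⟩ := hs
  have : Nontrivial R := Submodule.nontrivial_iff_ne_bot.2 fun hbot =>
    htop (eq_top_of_isCompl_bot (hbot ▸ hR))
  have hRcompl : IsComplemented R := ⟨_, hR.symm⟩
  obtain ⟨P, D, hPD, hD⟩ := exists_isCompl_isIndecomposable (hM.of_isComplemented hRcompl)
    (hS.of_isComplemented hRcompl)
  let D' : Submodule A M := D.map R.subtype
  have hD' : IsIndecomposable A D' := hD.of_linearEquiv (R.equivSubtypeMap D)
  have hdisj : Disjoint (sSup s) D' := hR.disjoint.mono_right (Submodule.map_subtype_le R D)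
  have hnotMem : D' ∉ s := fun hmem =>
    Submodule.nontrivial_iff_ne_bot.1 hD'.nontrivial
      (disjoint_self.1 (hdisj.mono_left (le_sSup hmem)))
  refine ⟨insert D' s, Set.ssubset_insert hnotMem, sSupIndep_insert hind hdisj,
    Set.forall_mem_insert.2 ⟨hD', hindec⟩, P.map R.subtype, ?_⟩
  rw [sSup_insert, sup_comm]
  exact isCompl_sup_map_subtype hR hPD.symm

theorem exists_sSupIndep_isIndecomposable (hM : IsCountablyGenerated A M)
    (hS : HasStableOrbits A M) :
    ∃ s : Set (Submodule A M), sSupIndep s ∧ sSup s = ⊤ ∧ ∀ D ∈ s, IsIndecomposable A D := by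
  obtain ⟨s, -, hs, hmax⟩ := zorn_subset_nonempty {s | IsPartialDecomposition (A := A) (M := M) s}
    (fun c hc hchain hne => ⟨⋃₀ c, isPartialDecomposition_sUnion hM hS hne hchain.directedOn hc,
      fun _ => Set.subset_sUnion_of_mem⟩)
    ∅ ⟨sSupIndep_empty, by simp, by simpa using isComplemented_bot⟩
  refine ⟨s, hs.independent, by_contra fun htop => ?_, hs.isIndecomposable⟩
  obtain ⟨s', hlt, hs'⟩ := hs.exists_ssubset hM hS htop
  exact hlt.2 (hmax hs' hlt.1)

theorem isSummableFamily_of_finite_support {M : Type v} [AddCommGroup M] [Module A M]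
    {ι : Type*} {N : ι → Type v} [∀ i, AddCommGroup (N i)] [∀ i, Module A (N i)]
    (f : ∀ i, M →ₗ[A] N i) (h : ∀ x, {i | f i x ≠ 0}.Finite) : IsSummableFamily f := by
  classical
  let g (x : M) : ⨁ i, N i := DirectSum.mk N (h x).toFinset fun i => f i x
  have hg (x : M) (i : ι) : g x i = f i x := by
    by_cases hi : i ∈ (h x).toFinset
    · exact DirectSum.mk_apply_of_mem hi
    · rw [DirectSum.mk_apply_of_notMem hi]
      simpa [eq_comm] using hi
  refine ⟨{ toFun := g, map_add' := fun x y => ?_, map_smul' := fun a x => ?_ },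
    fun i x => hg x i⟩
  · ext i
    rw [DirectSum.add_apply, hg, hg, hg, map_add]
  · ext i
    rw [RingHom.id_apply, DirectSum.smul_apply, hg, hg, map_smul]

theorem exists_partialComp_apply_eq_zero (hM : IsCountablyGenerated A M) (hS : HasStableOrbits A M)
    {N : ℕ → Type*} [∀ n, AddCommGroup (N n)] [∀ n, Module A (N n)]
    (i : ∀ n, N n →ₗ[A] M) (π : ∀ n, M →ₗ[A] N n) (hπ : ∀ n, Function.LeftInverse (π n) (i n))
    (hN : ∀ n, IsIndecomposable A (N n)) (f : ∀ n, N n →ₗ[A] N (n + 1))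
    (hf : ∀ n, ¬ Function.Bijective (f n)) (x : N 0) : ∃ n, partialComp f n x = 0 := by
  have hcg (n : ℕ) : IsCountablyGenerated A (N n) := hM.of_surjective (π n) (hπ n).surjective
  have hstable (n : ℕ) : HasStableOrbits A (N n) := hS.of_leftInverse (i n) (π n) (hπ n)
  obtain ⟨n, t, ht⟩ := hS.exists_leftInverse_partialComp i π hπ f {x}
  refine ⟨n, by_contra fun hne => hf n ?_⟩
  exact (hN n).bijective_of_apply_apply_eq_self (hcg n) (hstable n) (hN (n + 1)) (hcg (n + 1))
    (hstable (n + 1)) hne (ht x (Finset.mem_singleton_self x))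

theorem isLocallyTNilpotent_of_isIndecomposable {A : Type u} [Ring A] {M : Type v} [AddCommGroup M]
    [Module A M] (hM : IsCountablyGenerated A M) (hS : HasStableOrbits A M) {Z : Type w}
    (N : Z → Submodule A M) (hN : ∀ z, IsComplemented (N z))
    (hindec : ∀ z, IsIndecomposable A (N z)) : IsLocallyTNilpotent A fun z => N z := by
  refine ⟨fun z => (hindec z).nontrivial, fun z f hf =>
    isSummableFamily_of_finite_support _ fun x => ?_⟩
  choose Q hQ using hN
  obtain ⟨n, hn⟩ := exists_partialComp_apply_eq_zero hM hS (fun n => (N (z n)).subtype)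
    (fun n => (N (z n)).projectionOnto (Q (z n)) (hQ (z n)))
    (fun n => Submodule.projectionOnto_apply_left (hQ (z n))) (fun n => hindec (z n)) f hf x
  refine (Set.finite_lt_nat n).subset fun m hm => (not_le.1 fun hnm => hm ?_ : m < n)
  rw [seqComp_eq_partialComp_succ]
  exact partialComp_apply_eq_zero_of_le f (hnm.trans m.le_succ) hn

theorem isComplemented_of_mem_sSupIndep {s : Set (Submodule A M)} (hs : sSupIndep s)
    (htop : sSup s = ⊤) {D : Submodule A M} (hD : D ∈ s) : IsComplemented D := by
  refine ⟨sSup (s \ {D}), hs hD, ?_⟩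
  rw [codisjoint_iff, ← sSup_insert, Set.insert_sdiff_singleton, Set.insert_eq_of_mem hD, htop]

end Decomposition

end PerfectDecomp

theorem mainTheorem9 {A : Type u} [Ring A] {M : Type v} [AddCommGroup M] [Module A M]
    (hM : PerfectDecomp.IsCountablyGenerated A M)
    (hcoperf : PerfectDecomp.IsEndoSigmaCoperfect A M) :
    PerfectDecomp.HasPerfectDecomposition A M := by
  classical
  have hS := hcoperf.hasStableOrbits
  obtain ⟨s, hind, htop, hindec⟩ := PerfectDecomp.exists_sSupIndep_isIndecomposable hM hS
  have hinternal : DirectSum.IsInternal fun D : s => (D : Submodule A M) :=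
    DirectSum.isInternal_submodule_of_iSupIndep_of_iSup_eq_top ((sSupIndep_iff s).1 hind)
      (by rw [← sSup_eq_iSup', htop])
  exact ⟨s, fun D => (D : Submodule A M), inferInstance, inferInstance,
    PerfectDecomp.isLocallyTNilpotent_of_isIndecomposable hM hS _
      (fun D => PerfectDecomp.isComplemented_of_mem_sSupIndep hind htop D.2)
      (fun D => hindec D D.2),
    ⟨(LinearEquiv.ofBijective (DirectSum.coeLinearMap _) hinternal).symm⟩⟩
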